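/- For $n\ge 0$ and $p\in[0,1]$ let $G(n,p)$ be the random graph on $n$ labelled vertices in which each of the $\binom n2$ edges is present independently with probability $p$, and let $\nu_n$ be its number of connected components. Write $z^{\underline s}=z(z-1)\cdots(z-s+1)$ (with $z^{\underline 0}=1$), and let $\beta(x)=\sum_{k\ge1}\frac{k^{k-2}}{k!}x^k$, which converges for $|x|\le e^{-1}$. Let $\alpha\ge0$ be fixed, and let $p=p(n)\in[0,1]$, $q=q(n)=1-p(n)$, be such that $q(n)^n\to e^{-\alpha}$ as $n\to\infty$. Then for each fixed integer $s\ge0$, as $n\to\infty$: if $\alpha>0$, then $$\mathsf E(\nu_n-1)^{\underline s}=\Bigl(\frac n\alpha\,\beta(\alpha e^{-\alpha})\Bigr)^s(1+o(1));$$ if $\alpha=0$, then $\mathsf E(\nu_n-1)^{\underline s}=n^s(1+o(1))$. -/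

import Mathlib

open Filter Topology MeasureTheory Asymptotics
open scoped Nat

namespace ErdosRenyi

/-- The number of connected components of a graph on the labelled vertices `0, …, n - 1`. -/
noncomputable def numComponents {n : ℕ} (g : SimpleGraph (Fin n)) : ℕ :=
  Nat.card g.ConnectedComponent

/-- The factorial moment `E (ν_n - 1)(ν_n - 2) ⋯ (ν_n - s)`, where `ν_n` is the number of connected
components of the random graph `G(n, p)`; `descPochhammer ℝ s` is the polynomial
`z (z - 1) ⋯ (z - s + 1)`. -/
noncomputable def factorialMoment (n : ℕ) (p : unitInterval) (s : ℕ) : ℝ :=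
  ∫ g, (descPochhammer ℝ s).eval ((numComponents g : ℝ) - 1)
    ∂(SimpleGraph.binomialRandom (Fin n) p)

/-- The `k`-th term `k ^ (k - 2) / k! * x ^ k` of the generating function of labelled trees. -/
noncomputable def treeTerm (x : ℝ) (k : ℕ) : ℝ :=
  (k : ℝ) ^ ((k : ℤ) - 2) / (k ! : ℝ) * x ^ k

/-- The generating function `β(x) = ∑_{k ≥ 1} k ^ (k - 2) / k! * x ^ k` of labelled trees. -/
noncomputable def beta (x : ℝ) : ℝ :=
  ∑' k : ℕ, treeTerm x (k + 1)

/-- The expectation that defines the factorial moment is that of an integrable function. -/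
theorem integrable_factorialMoment (n : ℕ) (p : unitInterval) (s : ℕ) :
    Integrable (fun g : SimpleGraph (Fin n) =>
      (descPochhammer ℝ s).eval ((numComponents g : ℝ) - 1))
      (SimpleGraph.binomialRandom (Fin n) p) := by
  haveI : MeasurableSingletonClass (SimpleGraph (Fin n)) := ⟨fun g => by
    have h := SimpleGraph.measurable_edgeSet (measurableSet_singleton g.edgeSet)
    convert h using 1
    ext g'
    simp⟩
  exact Integrable.of_finite

/-- The series defining `β` converges for `|x| ≤ 1 / e`. -/
theorem summable_treeTerm {x : ℝ} (hx : |x| ≤ Real.exp (-1)) :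
    Summable fun k : ℕ => treeTerm x (k + 1) := by
  have h2 : Summable fun k : ℕ => 1 / (((k + 1 : ℕ) : ℝ)) ^ 2 :=
    (summable_nat_add_iff (f := fun k : ℕ => 1 / (k : ℝ) ^ 2) 1).2
      (Real.summable_one_div_nat_pow.2 one_lt_two)
  refine Summable.of_norm_bounded h2 fun k => ?_
  generalize hm : k + 1 = m
  have hm0 : (0 : ℝ) < m := by rw [← hm]; positivity
  have h3 : (m : ℝ) ^ m / (m ! : ℝ) ≤ Real.exp m := Real.pow_div_factorial_le_exp _ hm0.le m
  have h4 : |x| ^ m ≤ Real.exp (-(m : ℝ)) := by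
    calc |x| ^ m ≤ Real.exp (-1) ^ m := by gcongr
      _ = Real.exp (-(m : ℝ)) := by rw [← Real.exp_nat_mul]; ring_nf
  have h5 : ‖treeTerm x m‖ = 1 / (m : ℝ) ^ 2 * ((m : ℝ) ^ m / (m ! : ℝ) * |x| ^ m) := by
    rw [treeTerm, zpow_sub₀ hm0.ne', Real.norm_eq_abs, abs_mul, abs_pow, abs_of_nonneg]
    · norm_cast
      field_simp
    · positivity
  rw [h5]
  have h6 : (m : ℝ) ^ m / (m ! : ℝ) * |x| ^ m ≤ 1 := by
    calc _ ≤ Real.exp m * Real.exp (-(m : ℝ)) := by gcongr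
      _ = 1 := by rw [← Real.exp_add]; simp
  calc _ ≤ 1 / (m : ℝ) ^ 2 * 1 := by gcongr
    _ = _ := mul_one _

end ErdosRenyi

/-!
Write `ν` for the number of components of `G(n, p)`, `q = 1 - p`, and `κ` for `β (α e⁻ᵅ) / α`
(`κ = 1` if `α = 0`). As `0 ≤ ν / n ≤ 1`, it is enough to show that `ν / n` tends to `κ` in mean:
the falling factorial of `ν - 1` divided by `n ^ s` is within `O(|ν / n - κ| + 1 / n)` of `κ ^ s`
(`exists_descPochhammer_bound`), so all factorial moments converge once this is known
(`tendsto_factorialMoment_div`).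

*Concentration.* Adding an edge changes `ν` by at most `1`, hence the variance of `ν` is at most
`p` times the number of pairs of vertices (`subsetMean_sq_le`), and `Var (ν / n) ≤ p → 0`.

*Expectation.* A set of `k` vertices is a component with probability `c_k q ^ (k (n - k))`, where
`c_k` is the probability that `G(k, p)` is connected, so `E ν = ∑ C(n, k) c_k q ^ (k (n - k))`.
Since there are at most `n / K` components with `K` or more vertices, the limit of `E ν / n` may be taken
term by term (`tendsto_sum_range_of_tail`), and it remains to know `c_k` to leading order as
`p → 0`. The component of a fixed vertex yields the recursion `sum_connProb` for the `c_k`, which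
involves cancellation. In terms of exponential generating functions it is equivalent to a quadratic
recursion with nonnegative terms (`connProb_succ`), which shows that `c_k = p ^ (k - 1) t_k (q)` for
a polynomial `t_k`, and at `q = 1` Abel's identity solves it by `t_k (1) = k ^ (k - 2)`
(`treePoly_one`). The terms of the limit are thus `k ^ (k - 2) α ^ (k - 1) e ^ (-α k) / k!`.
-/

namespace ErdosRenyi

/-! ### Means over a random subset of a finite set -/

/-- The expectation of `F S`, where `S` is a random subset of `E` that contains each element
independently with probability `p`. -/
def subsetMean {ι : Type*} (p : ℝ) (E : Finset ι) (F : Finset ι → ℝ) : ℝ :=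
  ∑ S ∈ E.powerset, p ^ S.card * (1 - p) ^ (E.card - S.card) * F S

section SubsetMean

variable {ι : Type*} {p : ℝ} {E : Finset ι} {F F' : Finset ι → ℝ}

lemma subsetMean_congr (h : ∀ S ⊆ E, F S = F' S) : subsetMean p E F = subsetMean p E F' :=
  Finset.sum_congr rfl fun S hS => by rw [h S (Finset.mem_powerset.1 hS)]

lemma subsetMean_add :
    subsetMean p E (fun S => F S + F' S) = subsetMean p E F + subsetMean p E F' := by
  simp only [subsetMean, mul_add, Finset.sum_add_distrib]

lemma subsetMean_const_mul (c : ℝ) :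
    subsetMean p E (fun S => c * F S) = c * subsetMean p E F := by
  simp only [subsetMean, Finset.mul_sum]
  exact Finset.sum_congr rfl fun S _ => by ring

lemma subsetMean_sub :
    subsetMean p E (fun S => F S - F' S) = subsetMean p E F - subsetMean p E F' := by
  simp only [subsetMean, mul_sub, Finset.sum_sub_distrib]

lemma subsetMean_sum {κ : Type*} (T : Finset κ) (G : κ → Finset ι → ℝ) :
    subsetMean p E (fun S => ∑ A ∈ T, G A S) = ∑ A ∈ T, subsetMean p E (G A) := by
  simp only [subsetMean, Finset.mul_sum]
  exact Finset.sum_comm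

lemma subsetMean_mono (hp0 : 0 ≤ p) (hp1 : p ≤ 1) (h : ∀ S ⊆ E, F S ≤ F' S) :
    subsetMean p E F ≤ subsetMean p E F' := by
  refine Finset.sum_le_sum fun S hS => ?_
  have : 0 ≤ 1 - p := by linarith
  exact mul_le_mul_of_nonneg_left (h S (Finset.mem_powerset.1 hS)) (by positivity)

lemma subsetMean_empty : subsetMean p ∅ F = F ∅ := by simp [subsetMean]

variable [DecidableEq ι]

/-- Conditioning on whether a given element belongs to the random subset. -/
lemma subsetMean_insert {e : ι} (he : e ∉ E) :
    subsetMean p (insert e E) F =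
      (1 - p) * subsetMean p E F + p * subsetMean p E (fun S => F (insert e S)) := by
  rw [subsetMean, Finset.sum_powerset_insert he, subsetMean, subsetMean, Finset.mul_sum,
    Finset.mul_sum, Finset.card_insert_of_notMem he]
  congr 1
  · refine Finset.sum_congr rfl fun S hS => ?_
    have := Finset.card_le_card (Finset.mem_powerset.1 hS)
    rw [Nat.succ_sub this, pow_succ]
    ring
  · refine Finset.sum_congr rfl fun S hS => ?_
    rw [Finset.card_insert_of_notMem fun h => he (Finset.mem_powerset.1 hS h),
      Nat.add_sub_add_right, pow_succ]
    ring

lemma subsetMean_const (c : ℝ) : subsetMean p E (fun _ => c) = c := by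
  induction E using Finset.induction_on with
  | empty => exact subsetMean_empty
  | insert e E he ih => rw [subsetMean_insert he, ih]; ring

/-- The parts of the random subset in two disjoint sets are independent. -/
lemma subsetMean_union {E₁ E₂ : Finset ι} (h : Disjoint E₁ E₂) :
    subsetMean p (E₁ ∪ E₂) F =
      subsetMean p E₁ (fun S₁ => subsetMean p E₂ (fun S₂ => F (S₁ ∪ S₂))) := by
  induction E₁ using Finset.induction_on generalizing F with
  | empty => simp [subsetMean_empty]
  | insert e E he ih =>
    rw [Finset.disjoint_insert_left] at h
    rw [Finset.insert_union, subsetMean_insert (by simp [he, h.1]), subsetMean_insert he,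
      ih h.2, ih h.2]
    simp only [Finset.insert_union]

lemma subsetMean_indicator_empty :
    subsetMean p E (fun S => if S = ∅ then 1 else 0) = (1 - p) ^ E.card := by
  simp [subsetMean]

lemma sq_subsetMean_le (hp0 : 0 ≤ p) (hp1 : p ≤ 1) :
    subsetMean p E F ^ 2 ≤ subsetMean p E (fun S => F S ^ 2) := by
  have h : subsetMean p E (fun _ => 0) ≤
      subsetMean p E (fun S => F S ^ 2 - 2 * subsetMean p E F * F S + subsetMean p E F ^ 2) :=
    subsetMean_mono hp0 hp1 fun S _ => by nlinarith [sq_nonneg (F S - subsetMean p E F)]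
  rw [subsetMean_const, subsetMean_add, subsetMean_sub, subsetMean_const_mul,
    subsetMean_const] at h
  linarith

/-- A variance bound of Efron–Stein type: if inserting an element changes `F` by at most `1`, then
each element of `E` contributes at most `p (1 - p) ≤ p` to the variance. -/
lemma subsetMean_sq_le (hp0 : 0 ≤ p) (hp1 : p ≤ 1) (hF : ∀ e S, |F (insert e S) - F S| ≤ 1) :
    subsetMean p E (fun S => F S ^ 2) ≤ subsetMean p E F ^ 2 + E.card * p := by
  induction E using Finset.induction_on generalizing F with
  | empty => simp [subsetMean_empty]
  | insert e E he ih =>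
    have h0 := ih hF
    have h1 := ih (F := fun S => F (insert e S)) fun e' S => by
      rw [Finset.insert_comm]
      exact hF e' (insert e S)
    rw [subsetMean_insert he, subsetMean_insert he, Finset.card_insert_of_notMem he]
    set a := subsetMean p E F
    set b := subsetMean p E fun S => F (insert e S)
    have hab : |b - a| ≤ 1 := by
      rw [abs_le]
      constructor
      · have := subsetMean_mono (E := E) hp0 hp1 (F := fun S => -1)
          (F' := fun S => F (insert e S) - F S) fun S _ => (abs_le.1 (hF e S)).1
        rwa [subsetMean_const, subsetMean_sub] at this
      · have := subsetMean_mono (E := E) hp0 hp1 (F' := fun S => 1)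
          (F := fun S => F (insert e S) - F S) fun S _ => (abs_le.1 (hF e S)).2
        rwa [subsetMean_const, subsetMean_sub] at this
    have hab2 : (b - a) ^ 2 ≤ 1 := (sq_le_one_iff_abs_le_one _).2 hab
    have h2 := mul_le_mul_of_nonneg_left h0 (sub_nonneg.2 hp1)
    have h3 := mul_le_mul_of_nonneg_left h1 hp0
    -- the variance between the two cases is `p (1 - p) (b - a) ^ 2`
    have h4 : p * (1 - p) * (b - a) ^ 2 ≤ p * 1 := by
      rw [mul_assoc]
      exact mul_le_mul_of_nonneg_left (by nlinarith [sq_nonneg (b - a)]) hp0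
    push_cast
    nlinarith

end SubsetMean

/-! ### Abel's identity -/

/-- Abel's generalization of the binomial theorem. -/
lemma abel_identity {y : ℝ} (hy : 0 < y) (m : ℕ) (x : ℝ) :
    ∑ j ∈ Finset.range (m + 1), (m.choose j : ℝ) * (x + j) ^ j *
      (y * (y + (m - j : ℕ)) ^ (m - j) / (y + (m - j : ℕ))) = (x + y + m) ^ m := by
  induction m generalizing x with
  | zero => simp [hy.ne']
  | succ m ih =>
    set f : ℝ → ℝ := fun x => ∑ j ∈ Finset.range (m + 1 + 1), ((m + 1).choose j : ℝ) *
      (x + j) ^ j * (y * (y + (m + 1 - j : ℕ)) ^ (m + 1 - j) / (y + (m + 1 - j : ℕ))) with hf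
    have hd : ∀ x, HasDerivAt (fun x => f x - (x + y + (m + 1 : ℕ)) ^ (m + 1)) 0 x := by
      intro x
      have h1 : HasDerivAt f (∑ j ∈ Finset.range (m + 1 + 1), ((m + 1).choose j : ℝ) *
          (j * (x + j) ^ (j - 1) * 1) *
          (y * (y + (m + 1 - j : ℕ)) ^ (m + 1 - j) / (y + (m + 1 - j : ℕ)))) x := by
        refine HasDerivAt.fun_sum fun j _ => HasDerivAt.mul_const ?_ _
        exact (((hasDerivAt_id x).add_const (j : ℝ)).pow j).const_mul _
      have h2 : HasDerivAt (fun x : ℝ => (x + y + (m + 1 : ℕ)) ^ (m + 1))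
          (((m + 1 : ℕ) : ℝ) * (x + y + (m + 1 : ℕ)) ^ (m + 1 - 1) * 1) x :=
        (((hasDerivAt_id x).add_const y).add_const ((m + 1 : ℕ) : ℝ)).pow (m + 1)
      refine (h1.sub h2).congr_deriv ?_
      have h3 := ih (x + 1)
      rw [Finset.sum_range_succ']
      simp only [Nat.cast_zero, zero_mul, mul_zero, add_zero, mul_one, Nat.add_sub_cancel,
        Nat.add_sub_add_right]
      rw [show x + y + ((m + 1 : ℕ) : ℝ) = x + 1 + y + m by push_cast; ring, ← h3,
        Finset.mul_sum, sub_eq_zero]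
      refine Finset.sum_congr rfl fun j _ => ?_
      have h4 : ((m + 1 : ℕ) : ℝ) * m.choose j = (m + 1).choose (j + 1) * (j + 1 : ℕ) := by
        exact_mod_cast Nat.add_one_mul_choose_eq m j
      rw [show x + ((j + 1 : ℕ) : ℝ) = x + 1 + j by push_cast; ring]
      linear_combination ((-1 : ℝ) * (x + 1 + j : ℝ) ^ j *
        (y * (y + (m - j : ℕ)) ^ (m - j) / (y + (m - j : ℕ)))) * h4
    -- at `x = -(y + m + 1)` the sum is an iterated difference of a polynomial of degree `m`
    have h0 : f (-(y + (m + 1 : ℕ))) = 0 := by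
      have h5 := congrFun (fwdDiff_iter_pow_eq_zero_of_lt (R := ℝ) (Nat.lt_succ_self m)) y
      rw [fwdDiff_iter_eq_sum_shift] at h5
      have h6 : f (-(y + (m + 1 : ℕ))) = y * ∑ k ∈ Finset.range (m + 1 + 1),
          ((-1 : ℤ) ^ (m + 1 - k) * ((m + 1).choose k : ℤ)) • (y + k • (1 : ℝ)) ^ m := by
        simp only [hf]
        rw [← Finset.sum_range_reflect, Finset.mul_sum]
        refine Finset.sum_congr rfl fun k hk => ?_
        have hk' : k ≤ m + 1 := by simpa [Nat.lt_succ_iff] using hk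
        obtain ⟨i, hi⟩ := Nat.exists_eq_add_of_le hk'
        have e1 : m + 1 + 1 - 1 - k = i := by omega
        have e2 : m + 1 - i = k := by omega
        have e3 : m + 1 - k = i := by omega
        have e4 : (m + 1).choose i = (m + 1).choose k := by
          rw [← Nat.choose_symm hk', e3]
        have hyk : y + (k : ℝ) ≠ 0 := by positivity
        have e5 : (y + (k : ℝ)) ^ i * (y + k) ^ k = (y + k) ^ m * (y + k) := by
          rw [← pow_add, ← pow_succ, hi, Nat.add_comm k i]
        have e6 : (y + (k : ℝ)) ^ i * (y * (y + k) ^ k / (y + k)) = y * (y + k) ^ m := by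
          rw [mul_div_assoc', div_eq_iff hyk]
          linear_combination y * e5
        rw [e1, e2, e3, e4, show -(y + ((m + 1 : ℕ) : ℝ)) + i = -1 * (y + k) by
          rw [hi]; push_cast; ring, mul_pow, zsmul_eq_mul, nsmul_eq_mul, mul_one]
        push_cast
        linear_combination ((m + 1).choose k : ℝ) * (-1) ^ i * e6
      rw [h6]
      simp only [Nat.succ_eq_add_one] at h5
      rw [h5]; simp
    have hconst := is_const_of_deriv_eq_zero (fun x => (hd x).differentiableAt)
      (fun x => (hd x).deriv) x (-(y + (m + 1 : ℕ)))
    simp only [h0] at hconst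
    rw [show -(y + ((m + 1 : ℕ) : ℝ)) + y + (m + 1 : ℕ) = 0 by ring] at hconst
    simp only [ne_eq, Nat.add_eq_zero_iff, one_ne_zero, and_false, not_false_eq_true, zero_pow,
      sub_zero] at hconst
    linarith

/-! ### The probability that a random graph is connected -/

/-- `connProb q m` is the probability that the random graph on `m + 1` vertices, with edge
probability `1 - q`, is connected. It is defined through the law of total probability for the
vertex set of the component of a given vertex, see `sum_connProb`. -/
noncomputable def connProb (q : ℝ) : ℕ → ℝ
  | m => 1 - ∑ j : Fin m, (m.choose j : ℝ) * connProb q j * q ^ ((j + 1) * (m - j : ℕ))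

lemma sum_connProb (q : ℝ) (m : ℕ) :
    ∑ j ∈ Finset.range (m + 1), (m.choose j : ℝ) * connProb q j * q ^ ((j + 1) * (m - j)) = 1 := by
  rw [Finset.sum_range_succ, connProb.eq_1 q m, Finset.sum_range]
  simp

open PowerSeries in
/-- The quadratic recursion behind the positivity of the tree polynomials. With
`G = ∑ q ^ (-n (n - 1) / 2) x ^ n / n!` and `D` the derivative of the exponential generating
function of the connected graphs, `sum_connProb` says `G' = D G`, while `G' (x) = G (x / q)`.
Differentiating the first equation and cancelling `G` gives
`D' (x) = D (x) (q⁻¹ D (x / q) - D (x))`. -/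
lemma connProb_succ {q : ℝ} (hq : q ≠ 0) (m : ℕ) :
    connProb q (m + 1) = ∑ j ∈ Finset.range (m + 1), (m.choose j : ℝ) * connProb q j *
      connProb q (m - j) * ((1 - q ^ (j + 1)) * q ^ ((j + 1) * (m - j))) := by
  set r := q⁻¹ with hr
  set G : ℝ⟦X⟧ := PowerSeries.mk fun n => r ^ (n.choose 2) / (n ! : ℝ) with hG
  set D : ℝ⟦X⟧ := PowerSeries.mk fun n => connProb q n * r ^ ((n + 1).choose 2) / (n ! : ℝ) with hD
  have hrq : ∀ a b : ℕ, r ^ (a + b) * q ^ b = r ^ a := fun a b => by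
    rw [pow_add, mul_assoc, ← mul_pow, hr, inv_mul_cancel₀ hq, one_pow, mul_one]
  clear_value r
  have hfac : ∀ n : ℕ, (n ! : ℝ) ≠ 0 := fun n => by positivity
  have choose_two : ∀ a b : ℕ, (a + b).choose 2 = a.choose 2 + b.choose 2 + a * b := fun a b => by
    induction b with
    | zero => simp
    | succ b ih =>
      rw [← add_assoc, Nat.choose_succ_succ' (a + b) 1, Nat.choose_succ_succ' b 1, ih]
      simp only [Nat.choose_one_right]
      ring
  have hG1 : derivative ℝ G = rescale r G := by
    ext n
    rw [coeff_derivative, coeff_rescale, hG, coeff_mk, coeff_mk, Nat.factorial_succ,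
      choose_two n 1]
    have := hfac n
    push_cast
    field_simp
    simp [pow_add]
    ring
  have hG2 : derivative ℝ G = D * G := by
    ext n
    rw [hG1, coeff_rescale, coeff_mul, Finset.Nat.sum_antidiagonal_eq_sum_range_succ_mk, hG, hD]
    simp only [coeff_mk]
    have h1 : r ^ n * (r ^ n.choose 2 / (n ! : ℝ)) = r ^ (n + 1).choose 2 / (n ! : ℝ) *
        ∑ j ∈ Finset.range (n + 1),
          (n.choose j : ℝ) * connProb q j * q ^ ((j + 1) * (n - j)) := by
      rw [sum_connProb, choose_two n 1]
      simp [pow_add]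
      ring
    rw [h1, Finset.mul_sum]
    refine Finset.sum_congr rfl fun j hj => ?_
    have hj' : j ≤ n := by simpa [Nat.lt_succ_iff] using hj
    rw [show n + 1 = (j + 1) + (n - j) by omega, choose_two (j + 1) (n - j),
      Nat.cast_choose ℝ hj']
    have e := hrq ((j + 1).choose 2 + (n - j).choose 2) ((j + 1) * (n - j))
    generalize r ^ ((j + 1).choose 2 + (n - j).choose 2 + (j + 1) * (n - j)) = x at e ⊢
    rw [pow_add] at e
    have := hfac n
    have := hfac j
    have := hfac (n - j)
    field_simp
    linear_combination connProb q j * e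
  have hG0 : G ≠ 0 := fun h => by
    have : coeff 0 G = 0 := by rw [h]; simp
    simp [hG] at this
  have hDD : derivative ℝ D = D * (C r * rescale r D - D) := by
    have h1 : derivative ℝ (rescale r G) = C r * rescale r (derivative ℝ G) := by
      ext n
      simp only [coeff_derivative, coeff_rescale, coeff_C_mul]
      ring
    have h2 : derivative ℝ (derivative ℝ G) = derivative ℝ (D * G) := by rw [hG2]
    rw [hG1, h1, hG2, Derivation.leibniz, map_mul, ← hG1, hG2, smul_eq_mul, smul_eq_mul] at h2
    apply mul_right_cancel₀ hG0
    linear_combination -h2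
  have h3 := congrArg (coeff m) hDD
  rw [coeff_derivative, mul_comm D, coeff_mul, Finset.Nat.sum_antidiagonal_eq_sum_range_succ_mk]
    at h3
  simp only [map_sub, coeff_C_mul, coeff_rescale, hD, coeff_mk] at h3
  have h4 : connProb q (m + 1) * r ^ (m + 1 + 1).choose 2 / (m ! : ℝ) =
      ∑ j ∈ Finset.range (m + 1), (r ^ (m + 1 + 1).choose 2 / (m ! : ℝ)) *
        ((m.choose j : ℝ) * connProb q j * connProb q (m - j) *
          ((1 - q ^ (j + 1)) * q ^ ((j + 1) * (m - j)))) := by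
    rw [Nat.factorial_succ] at h3
    have := hfac m
    rw [show connProb q (m + 1) * r ^ (m + 1 + 1).choose 2 / (m ! : ℝ) =
      connProb q (m + 1) * r ^ (m + 1 + 1).choose 2 / ((m + 1) * m ! : ℕ) * (m + 1) by
        push_cast; field_simp, h3]
    refine Finset.sum_congr rfl fun j hj => ?_
    have hj' : j ≤ m := by simpa [Nat.lt_succ_iff] using hj
    have := hfac j
    have := hfac (m - j)
    rw [show m + 1 + 1 = (j + 1) + (m - j + 1) by omega, choose_two (j + 1) (m - j + 1),
      Nat.cast_choose ℝ hj', Nat.mul_add_one, add_comm ((j + 1) * (m - j)), ← add_assoc]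
    have e1 := hrq ((j + 1).choose 2 + (m - j + 1).choose 2 + (j + 1)) ((j + 1) * (m - j))
    have e2 := hrq ((j + 1).choose 2 + (m - j + 1).choose 2) (j + 1)
    generalize r ^ ((j + 1).choose 2 + (m - j + 1).choose 2 + (j + 1) + (j + 1) * (m - j)) = x
      at e1 ⊢
    rw [pow_add _ _ (j + 1)] at e1 e2
    rw [pow_add] at e1 e2
    field_simp
    linear_combination (-connProb q j * connProb q (m - j)) * (e1 - q ^ (j + 1) * e1 - e2)
  rw [← Finset.mul_sum, mul_div_assoc, mul_comm] at h4
  have hr0 : r ≠ 0 := hr ▸ inv_ne_zero hq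
  exact mul_left_cancel₀ (div_ne_zero (pow_ne_zero _ hr0) (hfac m)) h4

/-- The polynomials in `q` with `connProb q m = (1 - q) ^ m * treePoly q m`, so that `treePoly 1 m`
is the number of trees on `m + 1` labelled vertices. -/
noncomputable def treePoly (q : ℝ) : ℕ → ℝ
  | 0 => 1
  | m + 1 => ∑ j : Fin (m + 1), (m.choose j : ℝ) * treePoly q j * treePoly q (m - j) *
      ((∑ i ∈ Finset.range (j + 1), q ^ i) * q ^ (((j : ℕ) + 1) * (m - j)))

lemma treePoly_succ (q : ℝ) (m : ℕ) :
    treePoly q (m + 1) = ∑ j ∈ Finset.range (m + 1), (m.choose j : ℝ) * treePoly q j *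
      treePoly q (m - j) * ((∑ i ∈ Finset.range (j + 1), q ^ i) * q ^ ((j + 1) * (m - j))) := by
  rw [treePoly, Finset.sum_range]

lemma connProb_eq {q : ℝ} (hq : q ≠ 0) (m : ℕ) : connProb q m = (1 - q) ^ m * treePoly q m := by
  induction m using Nat.strong_induction_on with
  | _ m ih =>
    cases m with
    | zero => rw [connProb]; simp [treePoly]
    | succ m =>
      rw [connProb_succ hq, treePoly_succ, Finset.mul_sum]
      refine Finset.sum_congr rfl fun j hj => ?_
      have hj' : j ≤ m := by simpa [Nat.lt_succ_iff] using hj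
      rw [ih j (by omega), ih (m - j) (by omega), ← geom_sum_mul_neg q (j + 1)]
      have : (1 - q) ^ (m + 1) = (1 - q) ^ j * (1 - q) ^ (m - j) * (1 - q) := by
        rw [← pow_add, ← pow_succ]; congr 1; omega
      rw [this]
      ring

lemma treePoly_nonneg {q : ℝ} (hq : 0 ≤ q) (m : ℕ) : 0 ≤ treePoly q m := by
  induction m using Nat.strong_induction_on with
  | _ m ih =>
    cases m with
    | zero => simp [treePoly]
    | succ m =>
      rw [treePoly_succ]
      refine Finset.sum_nonneg fun j hj => ?_
      have hj' : j ≤ m := by simpa [Nat.lt_succ_iff] using hj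
      have h1 := ih j (by omega)
      have h2 := ih (m - j) (by omega)
      have h3 : 0 ≤ ∑ i ∈ Finset.range (j + 1), q ^ i := Finset.sum_nonneg fun i _ => by positivity
      positivity

lemma continuous_treePoly (m : ℕ) : Continuous fun q => treePoly q m := by
  induction m using Nat.strong_induction_on with
  | _ m ih =>
    cases m with
    | zero => simp only [treePoly]; fun_prop
    | succ m =>
      simp only [treePoly_succ]
      refine continuous_finsetSum _ fun j hj => ?_
      have hj' : j ≤ m := by simpa [Nat.lt_succ_iff] using hj
      have h1 := ih j (by omega)
      have h2 := ih (m - j) (by omega)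
      fun_prop

/-- Cayley's formula. -/
lemma treePoly_one (m : ℕ) : treePoly 1 m = ((m : ℝ) + 1) ^ m / (m + 1) := by
  induction m using Nat.strong_induction_on with
  | _ m ih =>
    cases m with
    | zero => simp [treePoly]
    | succ m =>
      have h := abel_identity one_pos m 1
      rw [treePoly_succ, show (((m + 1 : ℕ) : ℝ) + 1) ^ (m + 1) / (((m + 1 : ℕ) : ℝ) + 1) =
        (1 + 1 + m) ^ m by rw [pow_succ]; push_cast; field_simp; ring, ← h]
      refine Finset.sum_congr rfl fun j hj => ?_
      have hj' : j ≤ m := by simpa [Nat.lt_succ_iff] using hj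
      rw [ih j (by omega), ih (m - j) (by omega)]
      simp only [one_pow, Finset.sum_const, Finset.card_range, nsmul_eq_mul, mul_one, one_mul]
      rw [add_comm (1 : ℝ) j, add_comm (1 : ℝ) ((m - j : ℕ) : ℝ)]
      push_cast
      field_simp

/-! ### Components of a random graph -/

section Components

variable {V : Type*}

/-- The pairs of distinct vertices of `A`, as unordered pairs. -/
def edgesInside [DecidableEq V] (A : Finset V) : Finset (Sym2 V) :=
  A.sym2.filter fun e => ¬ e.IsDiag

/-- The unordered pairs with one vertex in `A` and one in `B`. -/
def edgesBetween [DecidableEq V] (A B : Finset V) : Finset (Sym2 V) :=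
  (A ×ˢ B).image fun x => s(x.1, x.2)

/-- The graph on `V` with edge set `S` (loops are discarded). -/
abbrev graphOf (S : Finset (Sym2 V)) : SimpleGraph V := SimpleGraph.fromEdgeSet (S : Set (Sym2 V))

/-- `A` is the vertex set of a connected component of the graph with edge set `S`. -/
def IsComponent (A : Finset V) (S : Finset (Sym2 V)) : Prop :=
  A.Nonempty ∧ ∀ x ∈ A, ∀ y, (graphOf S).Reachable x y ↔ y ∈ A

/-- Any two vertices of `A` are joined by a path of edges in `S`. -/
def ConnectedOn (A : Finset V) (S : Finset (Sym2 V)) : Prop :=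
  ∀ x ∈ A, ∀ y ∈ A, (graphOf S).Reachable x y

lemma mem_edgesInside [DecidableEq V] {A : Finset V} {x y : V} :
    s(x, y) ∈ edgesInside A ↔ x ∈ A ∧ y ∈ A ∧ x ≠ y := by
  simp [edgesInside, and_assoc]

lemma mem_edgesBetween [DecidableEq V] {A B : Finset V} {x y : V} :
    s(x, y) ∈ edgesBetween A B ↔ x ∈ A ∧ y ∈ B ∨ y ∈ A ∧ x ∈ B := by
  simp only [edgesBetween, Finset.mem_image, Finset.mem_product, Prod.exists, Sym2.eq_iff]
  grind

lemma card_edgesBetween [DecidableEq V] {A B : Finset V} (h : Disjoint A B) :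
    (edgesBetween A B).card = A.card * B.card := by
  rw [edgesBetween, Finset.card_image_of_injOn, Finset.card_product]
  rintro ⟨a, b⟩ hx ⟨c, d⟩ hy hxy
  simp only [Finset.coe_product, Set.mem_prod, Finset.mem_coe, Sym2.eq_iff] at hx hy hxy
  rcases hxy with ⟨rfl, rfl⟩ | ⟨rfl, rfl⟩
  · rfl
  · exact absurd hy.2 (Finset.disjoint_left.1 h hx.1)

lemma edgesInside_eq_union [DecidableEq V] {A W : Finset V} (h : A ⊆ W) :
    edgesInside W = edgesInside A ∪ (edgesBetween A (W \ A) ∪ edgesInside (W \ A)) := by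
  ext e
  induction e using Sym2.ind with
  | _ x y =>
    simp only [Finset.mem_union, mem_edgesInside, mem_edgesBetween, Finset.mem_sdiff]
    have := @h x
    have := @h y
    grind

lemma disjoint_edgesInside [DecidableEq V] {A W : Finset V} :
    Disjoint (edgesInside A) (edgesBetween A (W \ A) ∪ edgesInside (W \ A)) := by
  rw [Finset.disjoint_left]
  intro e
  induction e using Sym2.ind with
  | _ x y =>
    simp only [Finset.mem_union, mem_edgesInside, mem_edgesBetween, Finset.mem_sdiff]
    grind

lemma disjoint_edgesBetween [DecidableEq V] {A W : Finset V} :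
    Disjoint (edgesBetween A (W \ A)) (edgesInside (W \ A)) := by
  rw [Finset.disjoint_left]
  intro e
  induction e using Sym2.ind with
  | _ x y =>
    simp only [mem_edgesInside, mem_edgesBetween, Finset.mem_sdiff]
    grind

/-- `A` is a component if and only if the edges inside `A` connect it and no edge leaves it. -/
lemma isComponent_union_iff [DecidableEq V] {A W : Finset V} (hA : A.Nonempty)
    {S₁ S₂ S₃ : Finset (Sym2 V)} (h₁ : S₁ ⊆ edgesInside A) (h₂ : S₂ ⊆ edgesBetween A (W \ A))
    (h₃ : S₃ ⊆ edgesInside (W \ A)) :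
    IsComponent A (S₁ ∪ (S₂ ∪ S₃)) ↔ ConnectedOn A S₁ ∧ S₂ = ∅ := by
  have key : S₂ = ∅ → ∀ x ∈ A, ∀ y, (graphOf (S₁ ∪ (S₂ ∪ S₃))).Reachable x y →
      y ∈ A ∧ (graphOf S₁).Reachable x y := by
    rintro rfl x hx y hxy
    rw [SimpleGraph.reachable_iff_reflTransGen] at hxy
    induction hxy with
    | refl => exact ⟨hx, SimpleGraph.Reachable.refl x⟩
    | @tail y z _ hyz ih =>
      simp only [graphOf, SimpleGraph.fromEdgeSet_adj, Finset.mem_coe, Finset.mem_union,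
        Finset.empty_union] at hyz
      rcases hyz.1 with h | h
      · refine ⟨(mem_edgesInside.1 (h₁ h)).2.1, ih.2.trans (SimpleGraph.Adj.reachable ?_)⟩
        simpa [graphOf] using ⟨h, hyz.2⟩
      · have := (mem_edgesInside.1 (h₃ h)).1
        simp [ih.1] at this
  constructor
  · intro h
    have hS : S₂ = ∅ := by
      rw [Finset.eq_empty_iff_forall_notMem]
      intro e he
      induction e using Sym2.ind with
      | _ x y =>
        have hadj : x ≠ y → (graphOf (S₁ ∪ (S₂ ∪ S₃))).Reachable x y := fun hxy =>
          SimpleGraph.Adj.reachable (by simp [graphOf, he, hxy])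
        have h4 := mem_edgesBetween.1 (h₂ he)
        simp only [Finset.mem_sdiff] at h4
        rcases h4 with ⟨hx, -, hy⟩ | ⟨hy, -, hx⟩
        · exact hy ((h.2 x hx y).1 (hadj (by rintro rfl; exact hy hx)))
        · exact hx ((h.2 y hy x).1 (hadj (by rintro rfl; exact hx hy)).symm)
    exact ⟨fun x hx y hy => (key hS x hx y ((h.2 x hx y).2 hy)).2, hS⟩
  · rintro ⟨h, hS⟩
    refine ⟨hA, fun x hx y => ⟨fun hxy => (key hS x hx y hxy).1, fun hy => (h x hx y hy).mono ?_⟩⟩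
    exact SimpleGraph.fromEdgeSet_mono (by simp)

open scoped Classical in
/-- The probability that the random graph on the vertex set `A` is connected. -/
noncomputable def connMean [DecidableEq V] (p : ℝ) (A : Finset V) : ℝ :=
  subsetMean p (edgesInside A) fun S => if ConnectedOn A S then 1 else 0

open scoped Classical in
/-- The probability that `A` is a component of the random graph on `W`. -/
lemma subsetMean_isComponent [DecidableEq V] (p : ℝ) {A W : Finset V} (hA : A.Nonempty) (h : A ⊆ W) :
    subsetMean p (edgesInside W) (fun S => if IsComponent A S then 1 else 0) =
      connMean p A * (1 - p) ^ (A.card * (W.card - A.card)) := by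
  rw [edgesInside_eq_union h, subsetMean_union disjoint_edgesInside]
  have h1 : ∀ S₁ ⊆ edgesInside A,
      subsetMean p (edgesBetween A (W \ A) ∪ edgesInside (W \ A))
        (fun S => if IsComponent A (S₁ ∪ S) then 1 else 0) =
      (1 - p) ^ (A.card * (W.card - A.card)) * if ConnectedOn A S₁ then 1 else 0 := by
    intro S₁ hS₁
    rw [subsetMean_union disjoint_edgesBetween]
    have h2 : ∀ S₂ ⊆ edgesBetween A (W \ A), subsetMean p (edgesInside (W \ A))
        (fun S₃ => if IsComponent A (S₁ ∪ (S₂ ∪ S₃)) then 1 else 0) =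
        (if ConnectedOn A S₁ then 1 else 0) * if S₂ = ∅ then 1 else 0 := by
      intro S₂ hS₂
      rw [subsetMean_congr (F' := fun _ => (if ConnectedOn A S₁ then 1 else 0) *
        if S₂ = ∅ then 1 else 0), subsetMean_const]
      intro S₃ hS₃
      simp only [isComponent_union_iff hA hS₁ hS₂ hS₃, ite_and]
      split_ifs <;> simp
    rw [subsetMean_congr h2, subsetMean_const_mul, subsetMean_indicator_empty,
      card_edgesBetween Finset.disjoint_sdiff, Finset.card_sdiff_of_subset h, mul_comm]
  rw [subsetMean_congr h1, subsetMean_const_mul, connMean, mul_comm]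

open scoped Classical in
/-- A given vertex of `W` lies in exactly one component of a graph on `W`. -/
lemma sum_isComponent_mem [DecidableEq V] {W : Finset V} {v : V} (hv : v ∈ W) {S : Finset (Sym2 V)}
    (hS : S ⊆ edgesInside W) :
    ∑ A ∈ W.powerset with v ∈ A, (if IsComponent A S then (1 : ℝ) else 0) = 1 := by
  rw [Finset.sum_eq_single (W.filter fun y => (graphOf S).Reachable v y)]
  · rw [if_pos]
    refine ⟨⟨v, by simp [hv]⟩, fun x hx y => ?_⟩
    simp only [Finset.mem_filter] at hx ⊢
    refine ⟨fun hxy => ⟨?_, hx.2.trans hxy⟩, fun hy => hx.2.symm.trans hy.2⟩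
    rw [SimpleGraph.reachable_iff_reflTransGen] at hxy
    induction hxy with
    | refl => exact hx.1
    | tail _ h _ =>
      simp only [graphOf, SimpleGraph.fromEdgeSet_adj, Finset.mem_coe] at h
      exact (mem_edgesInside.1 (hS h.1)).2.1
  · intro A hA hne
    rw [if_neg]
    intro hc
    apply hne
    simp only [Finset.mem_filter, Finset.mem_powerset] at hA
    ext y
    simp only [Finset.mem_filter]
    exact ⟨fun hy => ⟨hA.1 hy, (hc.2 v hA.2 y).2 hy⟩, fun hy => (hc.2 v hA.2 y).1 hy.2⟩
  · intro h
    exact absurd (by simp [hv]) h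

lemma sum_powerset_mem [DecidableEq V] {W : Finset V} {v : V} (hv : v ∈ W) (f : ℕ → ℝ) :
    ∑ A ∈ W.powerset with v ∈ A, f A.card =
      ∑ j ∈ Finset.range (W.card - 1 + 1), ((W.card - 1).choose j : ℝ) * f (j + 1) := by
  have h1 : ∑ A ∈ W.powerset with v ∈ A, f A.card =
      ∑ A ∈ (W.erase v).powerset, f (A.card + 1) := by
    refine Finset.sum_bij' (fun A _ => A.erase v) (fun A _ => insert v A) ?_ ?_ ?_ ?_ ?_
    · intro A hA
      simp only [Finset.mem_filter, Finset.mem_powerset] at hA ⊢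
      exact Finset.erase_subset_erase v hA.1
    · intro A hA
      simp only [Finset.mem_filter, Finset.mem_powerset] at hA ⊢
      exact ⟨Finset.insert_subset hv (hA.trans (Finset.erase_subset v W)),
        Finset.mem_insert_self v A⟩
    · intro A hA
      exact Finset.insert_erase (Finset.mem_filter.1 hA).2
    · intro A hA
      exact Finset.erase_insert fun h => by simpa using Finset.mem_powerset.1 hA h
    · intro A hA
      rw [Finset.card_erase_add_one (Finset.mem_filter.1 hA).2]
  rw [h1, Finset.sum_powerset_apply_card (fun k => f (k + 1)), Finset.card_erase_of_mem hv]
  simp only [nsmul_eq_mul]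

/-- The probability of being connected depends only on the number of vertices: both sides satisfy
the law of total probability for the component of a given vertex. -/
lemma connMean_eq [DecidableEq V] (p : ℝ) {A : Finset V} (hA : A.Nonempty) :
    connMean p A = connProb (1 - p) (A.card - 1) := by
  classical
  induction A using Finset.strongInduction with
  | _ W ih =>
    obtain ⟨v, hv⟩ := hA
    have h1 : ∑ A ∈ W.powerset with v ∈ A,
        connMean p A * (1 - p) ^ (A.card * (W.card - A.card)) = 1 := by
      refine Eq.trans ?_ ((subsetMean_congr fun S hS => sum_isComponent_mem hv hS).trans
        (subsetMean_const (p := p) (E := edgesInside W) 1))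
      rw [subsetMean_sum]
      refine Finset.sum_congr rfl fun A hA => ?_
      simp only [Finset.mem_filter, Finset.mem_powerset] at hA
      exact (subsetMean_isComponent p ⟨v, hA.2⟩ hA.1).symm
    have h2 : ∑ A ∈ W.powerset with v ∈ A,
        connProb (1 - p) (A.card - 1) * (1 - p) ^ (A.card * (W.card - A.card)) = 1 := by
      rw [sum_powerset_mem hv (fun k => connProb (1 - p) (k - 1) * (1 - p) ^ (k * (W.card - k)))]
      refine Eq.trans ?_ (sum_connProb (1 - p) (W.card - 1))
      refine Finset.sum_congr rfl fun j _ => ?_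
      rw [Nat.add_sub_cancel, mul_assoc, Nat.add_comm j 1, Nat.sub_sub]
    have hW : W ∈ W.powerset.filter fun A => v ∈ A := by simp [hv]
    have h3 : ∑ A ∈ (W.powerset.filter fun A => v ∈ A).erase W,
        connMean p A * (1 - p) ^ (A.card * (W.card - A.card)) =
        ∑ A ∈ (W.powerset.filter fun A => v ∈ A).erase W,
          connProb (1 - p) (A.card - 1) * (1 - p) ^ (A.card * (W.card - A.card)) := by
      refine Finset.sum_congr rfl fun A hA => ?_
      simp only [Finset.mem_erase, Finset.mem_filter, Finset.mem_powerset] at hA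
      rw [ih A (Finset.ssubset_iff_subset_ne.2 ⟨hA.2.1, hA.1⟩) ⟨v, hA.2.2⟩]
    rw [← Finset.add_sum_erase _ _ hW] at h1 h2
    rw [h3] at h1
    have h4 := add_right_cancel (h1.trans h2.symm)
    simpa using h4

open scoped Classical in
lemma card_connectedComponent_eq [Fintype V] (S : Finset (Sym2 V)) :
    (Nat.card (graphOf S).ConnectedComponent : ℝ) =
      ∑ A ∈ (Finset.univ : Finset V).powerset, if IsComponent A S then (1 : ℝ) else 0 := by
  rw [Finset.sum_boole, Nat.cast_inj, Nat.card_eq_fintype_card, ← Finset.card_univ]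
  refine Finset.card_bij (fun c _ => Finset.univ.filter fun y => y ∈ c.supp) ?_ ?_ ?_
  · intro c _
    induction c using SimpleGraph.ConnectedComponent.ind with
    | _ v =>
      simp only [Finset.mem_filter, Finset.mem_powerset, Finset.subset_univ, true_and]
      refine ⟨⟨v, by simp⟩, fun x hx y => ?_⟩
      simp only [Finset.mem_filter, Finset.mem_univ, true_and,
        SimpleGraph.ConnectedComponent.mem_supp_iff, SimpleGraph.ConnectedComponent.eq] at hx ⊢
      exact ⟨fun h => h.symm.trans hx, fun h => hx.trans h.symm⟩
  · intro c _ d _ h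
    apply SimpleGraph.ConnectedComponent.supp_injective
    ext y
    simpa using congrArg (y ∈ ·) h
  · intro A hA
    simp only [Finset.mem_filter] at hA
    obtain ⟨v, hv⟩ := hA.2.1
    refine ⟨(graphOf S).connectedComponentMk v, Finset.mem_univ _, ?_⟩
    ext y
    simp only [Finset.mem_filter, Finset.mem_univ, true_and,
      SimpleGraph.ConnectedComponent.mem_supp_iff, SimpleGraph.ConnectedComponent.eq]
    rw [← hA.2.2 v hv y]
    exact ⟨fun h => h.symm, fun h => h.symm⟩

/-- The expected number of components. -/
lemma subsetMean_card_connectedComponent [Fintype V] [DecidableEq V] (p : ℝ) :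
    subsetMean p (edgesInside (Finset.univ : Finset V))
      (fun S => (Nat.card (graphOf S).ConnectedComponent : ℝ)) =
    ∑ k ∈ Finset.range (Fintype.card V), ((Fintype.card V).choose (k + 1) : ℝ) *
      connProb (1 - p) k * (1 - p) ^ ((k + 1) * (Fintype.card V - (k + 1))) := by
  classical
  simp only [card_connectedComponent_eq]
  rw [subsetMean_sum]
  set f : ℕ → ℝ := fun k => if k = 0 then 0 else
    connProb (1 - p) (k - 1) * (1 - p) ^ (k * (Fintype.card V - k)) with hf
  have h1 : ∀ A ∈ (Finset.univ : Finset V).powerset, subsetMean p (edgesInside Finset.univ)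
      (fun S => if IsComponent A S then 1 else 0) = f A.card := by
    intro A _
    rcases A.eq_empty_or_nonempty with rfl | hA
    · simp [hf, IsComponent, subsetMean_const]
    · have := subsetMean_isComponent p hA (Finset.subset_univ A)
      rw [connMean_eq p hA] at this
      simp only [hf, Finset.card_eq_zero, hA.ne_empty, if_false]
      rw [← Finset.card_univ, ← this]
  rw [Finset.sum_congr rfl h1, Finset.sum_powerset_apply_card, Finset.card_univ,
    Finset.sum_range_succ']
  simp [hf, mul_assoc]

/-- Adding an edge changes the number of components by at most `1`. -/
lemma abs_card_connectedComponent_insert [Fintype V] [DecidableEq V] (e : Sym2 V)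
    (S : Finset (Sym2 V)) :
    |(Nat.card (graphOf (insert e S)).ConnectedComponent : ℝ) -
      Nat.card (graphOf S).ConnectedComponent| ≤ 1 := by
  classical
  have hle : graphOf S ≤ graphOf (insert e S) := SimpleGraph.fromEdgeSet_mono (by simp)
  have h1 := SimpleGraph.ConnectedComponent.card_le_card_of_le hle
  have h2 : Nat.card (graphOf S).ConnectedComponent ≤
      Nat.card (graphOf (insert e S)).ConnectedComponent + 1 := by
    induction e using Sym2.ind with
    | _ u v =>
      -- two components that are merged by the edge `uv` are those of `u` and of `v`
      have key : ∀ x y, (graphOf (insert s(u, v) S)).Reachable x y → (graphOf S).Reachable x y ∨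
          ((graphOf S).Reachable x u ∧ (graphOf S).Reachable v y) ∨
          ((graphOf S).Reachable x v ∧ (graphOf S).Reachable u y) := by
        intro x y hxy
        rw [SimpleGraph.reachable_iff_reflTransGen] at hxy
        induction hxy with
        | refl => exact Or.inl (SimpleGraph.Reachable.refl x)
        | @tail y z _ hyz ih =>
          simp only [graphOf, SimpleGraph.fromEdgeSet_adj, Finset.mem_coe, Finset.mem_insert]
            at hyz
          rcases hyz.1 with h | h
          · rcases Sym2.eq_iff.1 h with ⟨rfl, rfl⟩ | ⟨rfl, rfl⟩
            · rcases ih with h | h | h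
              · exact Or.inr (Or.inl ⟨h, SimpleGraph.Reachable.refl _⟩)
              · exact Or.inr (Or.inl ⟨h.1, SimpleGraph.Reachable.refl _⟩)
              · exact Or.inl h.1
            · rcases ih with h | h | h
              · exact Or.inr (Or.inr ⟨h, SimpleGraph.Reachable.refl _⟩)
              · exact Or.inl h.1
              · exact Or.inr (Or.inr ⟨h.1, SimpleGraph.Reachable.refl _⟩)
          · have hr : (graphOf S).Reachable y z :=
              SimpleGraph.Adj.reachable (by simp [graphOf, h, hyz.2])
            rcases ih with h | h | h
            · exact Or.inl (h.trans hr)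
            · exact Or.inr (Or.inl ⟨h.1, h.2.trans hr⟩)
            · exact Or.inr (Or.inr ⟨h.1, h.2.trans hr⟩)
      rw [← Finite.card_option]
      refine Nat.card_le_card_of_injective (fun c : (graphOf S).ConnectedComponent =>
        if c = (graphOf S).connectedComponentMk u then none
        else some (c.map (SimpleGraph.Hom.ofLE hle))) ?_
      intro c d hcd
      induction c using SimpleGraph.ConnectedComponent.ind with | _ x =>
      induction d using SimpleGraph.ConnectedComponent.ind with | _ y =>
      simp only [SimpleGraph.ConnectedComponent.eq, SimpleGraph.ConnectedComponent.map_mk] at hcd ⊢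
      by_cases hx : (graphOf S).Reachable x u <;> by_cases hy : (graphOf S).Reachable y u
      · exact hx.trans hy.symm
      · simp [hx, hy] at hcd
      · simp [hx, hy] at hcd
      · simp only [hx, hy, if_false, Option.some.injEq, SimpleGraph.ConnectedComponent.eq] at hcd
        rcases key x y hcd with h | h | h
        · exact h
        · exact absurd h.1 hx
        · exact absurd h.2.symm hy
  rw [abs_le]
  have h1' : (Nat.card (graphOf (insert e S)).ConnectedComponent : ℝ) ≤
    Nat.card (graphOf S).ConnectedComponent := by exact_mod_cast h1
  have h2' : (Nat.card (graphOf S).ConnectedComponent : ℝ) ≤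
    Nat.card (graphOf (insert e S)).ConnectedComponent + 1 := by exact_mod_cast h2
  constructor <;> linarith

end Components

lemma card_edgesInside_univ (n : ℕ) :
    (edgesInside (Finset.univ : Finset (Fin n))).card = n.choose 2 := by
  rw [edgesInside, Finset.sym2_univ, ← Fintype.card_subtype, Sym2.card_subtype_not_diag,
    Fintype.card_fin]

/-- Expectations over `G(n, p)` are means over the random set of edges. -/
lemma integral_binomialRandom {n : ℕ} (p : unitInterval) (f : SimpleGraph (Fin n) → ℝ) :
    ∫ g, f g ∂(SimpleGraph.binomialRandom (Fin n) p) =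
      subsetMean (p : ℝ) (edgesInside Finset.univ) fun S => f (graphOf S) := by
  classical
  have : MeasurableSingletonClass (SimpleGraph (Fin n)) := ⟨fun g => by
    have h := SimpleGraph.measurable_edgeSet (measurableSet_singleton g.edgeSet)
    convert h using 1
    ext g'
    simp⟩
  have hE : edgesInside (Finset.univ : Finset (Fin n)) = Finset.univ.filter fun e => ¬ e.IsDiag := by
    simp [edgesInside]
  rw [integral_fintype Integrable.of_finite, subsetMean]
  refine Finset.sum_bij' (fun g _ => g.edgeFinset) (fun S _ => graphOf S) ?_ ?_ ?_ ?_ ?_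
  · intro g _
    rw [Finset.mem_powerset, hE]
    intro e he
    simpa using g.not_isDiag_of_mem_edgeSet (SimpleGraph.mem_edgeFinset.1 he)
  · simp
  · intro g _
    simp [graphOf]
  · intro S hS
    rw [Finset.mem_powerset, hE] at hS
    ext e
    simp only [graphOf, SimpleGraph.mem_edgeFinset, SimpleGraph.edgeSet_fromEdgeSet, Set.mem_sdiff,
      Finset.mem_coe]
    exact ⟨fun h => h.1, fun h => ⟨h, by simpa using hS h⟩⟩
  · intro g _
    rw [card_edgesInside_univ, measureReal_def, SimpleGraph.binomialRandom_singleton,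
      ← g.coe_edgeFinset, Set.ncard_coe_finset]
    simp [graphOf]

/-! ### The expected number of components -/

/-- The expected number of components with `k + 1` vertices of the random graph on `n` vertices with
edge probability `1 - q`. -/
noncomputable def compMean (q : ℝ) (n k : ℕ) : ℝ :=
  (n.choose (k + 1) : ℝ) * connProb q k * q ^ ((k + 1) * (n - (k + 1)))

/-- The limit of `compMean q n k / n` as `q ^ n` tends to `exp (-α)`. -/
noncomputable def compLimit (α : ℝ) (k : ℕ) : ℝ :=
  α ^ k * treePoly 1 k * Real.exp (-α) ^ (k + 1) / ((k + 1)! : ℝ)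

lemma compMean_nonneg {q : ℝ} (hq0 : 0 < q) (hq1 : q ≤ 1) (n k : ℕ) : 0 ≤ compMean q n k := by
  have h := treePoly_nonneg hq0.le k
  have h' : 0 ≤ 1 - q := by linarith
  rw [compMean, connProb_eq hq0.ne']
  positivity

/-- There are at most `n / (K + 1)` components with more than `K` vertices. -/
lemma sum_compMean_le {q : ℝ} (hq0 : 0 < q) (hq1 : q ≤ 1) (n K : ℕ) :
    ∑ k ∈ Finset.Ico K n, compMean q n k ≤ n / (K + 1) := by
  cases n with
  | zero => simp
  | succ m =>
    have h1 : ∀ k ∈ Finset.Ico K (m + 1), compMean q (m + 1) k ≤ ((m + 1 : ℕ) : ℝ) / (K + 1) *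
        ((m.choose k : ℝ) * connProb q k * q ^ ((k + 1) * (m - k))) := by
      intro k hk
      have h2 : ((m + 1 : ℕ) : ℝ) * m.choose k = (m + 1).choose (k + 1) * (k + 1 : ℕ) := by
        exact_mod_cast Nat.add_one_mul_choose_eq m k
      have h3 : compMean q (m + 1) k * (K + 1) ≤ compMean q (m + 1) k * (k + 1) :=
        mul_le_mul_of_nonneg_left (by exact_mod_cast Nat.add_le_add_right (Finset.mem_Ico.1 hk).1 1)
          (compMean_nonneg hq0 hq1 _ _)
      rw [div_mul_eq_mul_div, le_div_iff₀ (by positivity)]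
      refine h3.trans_eq ?_
      rw [compMean, Nat.add_sub_add_right]
      push_cast at h2 ⊢
      linear_combination (-connProb q k * q ^ ((k + 1) * (m - k))) * h2
    refine (Finset.sum_le_sum h1).trans ?_
    rw [← Finset.mul_sum]
    refine mul_le_of_le_one_right (by positivity) ?_
    rw [← sum_connProb q m]
    refine Finset.sum_le_sum_of_subset_of_nonneg (fun k => by simp) fun k _ _ => ?_
    have h := treePoly_nonneg hq0.le k
    have h' : 0 ≤ 1 - q := by linarith
    rw [connProb_eq hq0.ne']
    positivity

lemma eventually_pos_of_tendsto_pow {q : ℕ → ℝ} {α : ℝ} (hq0 : ∀ n, 0 ≤ q n)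
    (h : Tendsto (fun n => q n ^ n) atTop (𝓝 (Real.exp (-α)))) : ∀ᶠ n in atTop, 0 < q n := by
  filter_upwards [h.eventually (lt_mem_nhds (Real.exp_pos _)), eventually_ge_atTop 1] with n hn h1
  refine (hq0 n).lt_of_ne fun h0 => ?_
  rw [← h0, zero_pow (by omega)] at hn
  exact lt_irrefl _ hn

lemma tendsto_mul_log {q : ℕ → ℝ} {α : ℝ}
    (h : Tendsto (fun n => q n ^ n) atTop (𝓝 (Real.exp (-α)))) :
    Tendsto (fun n : ℕ => (n : ℝ) * Real.log (q n)) atTop (𝓝 (-α)) := by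
  have := ((Real.continuousAt_log (Real.exp_pos (-α)).ne').tendsto.comp h)
  rw [Real.log_exp] at this
  refine this.congr fun n => ?_
  simp [Real.log_pow]

lemma tendsto_one_of_tendsto_pow {q : ℕ → ℝ} {α : ℝ} (hq0 : ∀ n, 0 ≤ q n)
    (h : Tendsto (fun n => q n ^ n) atTop (𝓝 (Real.exp (-α)))) : Tendsto q atTop (𝓝 1) := by
  have h1 : Tendsto (fun n => Real.log (q n)) atTop (𝓝 0) := by
    have := (tendsto_mul_log h).mul (tendsto_inv_atTop_nhds_zero_nat (𝕜 := ℝ))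
    rw [mul_zero] at this
    refine this.congr' ?_
    filter_upwards [eventually_ge_atTop 1] with n hn
    have : (n : ℝ) ≠ 0 := by positivity
    field_simp
  have h2 := (Real.continuous_exp.tendsto 0).comp h1
  rw [Real.exp_zero] at h2
  refine h2.congr' ?_
  filter_upwards [eventually_pos_of_tendsto_pow hq0 h] with n hn
  exact Real.exp_log hn

lemma tendsto_mul_one_sub {q : ℕ → ℝ} {α : ℝ} (hq0 : ∀ n, 0 ≤ q n)
    (h : Tendsto (fun n => q n ^ n) atTop (𝓝 (Real.exp (-α)))) :
    Tendsto (fun n : ℕ => (n : ℝ) * (1 - q n)) atTop (𝓝 α) := by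
  have h1 : Tendsto (fun n : ℕ => -((n : ℝ) * Real.log (q n))) atTop (𝓝 α) := by
    simpa using (tendsto_mul_log h).neg
  have h2 : Tendsto (fun n : ℕ => q n * -((n : ℝ) * Real.log (q n))) atTop (𝓝 α) := by
    simpa using (tendsto_one_of_tendsto_pow hq0 h).mul h1
  refine tendsto_of_tendsto_of_tendsto_of_le_of_le' h2 h1 ?_ ?_
  · filter_upwards [eventually_pos_of_tendsto_pow hq0 h] with n hn
    have h3 := Real.one_sub_inv_le_log_of_pos hn
    have h4 : q n - 1 ≤ q n * Real.log (q n) := by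
      calc q n - 1 = q n * (1 - (q n)⁻¹) := by field_simp
        _ ≤ _ := mul_le_mul_of_nonneg_left h3 hn.le
    nlinarith [mul_le_mul_of_nonneg_left h4 (Nat.cast_nonneg (α := ℝ) n)]
  · filter_upwards [eventually_pos_of_tendsto_pow hq0 h] with n hn
    have h3 := Real.log_le_sub_one_of_pos hn
    nlinarith [mul_le_mul_of_nonneg_left h3 (Nat.cast_nonneg (α := ℝ) n)]

lemma tendsto_choose_div_pow (k : ℕ) :
    Tendsto (fun n : ℕ => (n.choose k : ℝ) / (n : ℝ) ^ k) atTop (𝓝 (1 / (k ! : ℝ))) := by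
  have h : Tendsto (fun n : ℕ => (n : ℝ) * (1 / n)) atTop (𝓝 1) := by
    refine tendsto_const_nhds.congr' ?_
    filter_upwards [eventually_ge_atTop 1] with n hn
    have : (n : ℝ) ≠ 0 := by positivity
    field_simp
  simpa [div_eq_mul_inv] using ProbabilityTheory.tendsto_choose_mul_pow_atTop k h

lemma tendsto_compMean_div {q : ℕ → ℝ} {α : ℝ} (hq0 : ∀ n, 0 ≤ q n)
    (h : Tendsto (fun n => q n ^ n) atTop (𝓝 (Real.exp (-α)))) (k : ℕ) :
    Tendsto (fun n => compMean (q n) n k / n) atTop (𝓝 (compLimit α k)) := by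
  have hq := tendsto_one_of_tendsto_pow hq0 h
  have h1 := (((tendsto_choose_div_pow (k + 1)).mul ((tendsto_mul_one_sub hq0 h).pow k)).mul
    (((continuous_treePoly k).tendsto 1).comp hq)).mul
    ((h.pow (k + 1)).mul ((hq.pow ((k + 1) * (k + 1))).inv₀ (by simp)))
  have h2 : 1 / ((k + 1)! : ℝ) * α ^ k * treePoly 1 k *
      (Real.exp (-α) ^ (k + 1) * (1 ^ ((k + 1) * (k + 1)))⁻¹) = compLimit α k := by
    rw [compLimit]; simp; ring
  rw [h2] at h1
  refine h1.congr' ?_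
  filter_upwards [eventually_pos_of_tendsto_pow hq0 h, eventually_ge_atTop (k + 1)] with n hn hk
  have hn0 : (n : ℝ) ≠ 0 := by
    have : 0 < n := by omega
    positivity
  have h3 : (q n ^ n) ^ (k + 1) * (q n ^ ((k + 1) * (k + 1)))⁻¹ =
      q n ^ ((k + 1) * (n - (k + 1))) := by
    rw [← div_eq_mul_inv, div_eq_iff (by positivity), ← pow_add, ← pow_mul]
    congr 1
    rw [← mul_add, Nat.sub_add_cancel hk, mul_comm]
  rw [h3, compMean, connProb_eq hn.ne', mul_pow, pow_succ]
  simp only [Function.comp_apply]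
  field_simp

lemma compLimit_nonneg {α : ℝ} (hα : 0 ≤ α) (k : ℕ) : 0 ≤ compLimit α k := by
  have := treePoly_nonneg zero_le_one k
  rw [compLimit]
  positivity

/-- A series version of dominated convergence, where domination is replaced by a bound on the tails
that is uniform in the parameter. -/
lemma tendsto_sum_range_of_tail {a : ℕ → ℕ → ℝ} {L b : ℕ → ℝ} {κ : ℝ} (hb : Tendsto b atTop (𝓝 0))
    (hL : HasSum L κ) (ha : ∀ k, Tendsto (fun n => a n k) atTop (𝓝 (L k)))
    (ht : ∀ K, ∀ᶠ n in atTop,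
      |∑ k ∈ Finset.range n, a n k - ∑ k ∈ Finset.range K, a n k| ≤ b K) :
    Tendsto (fun n => ∑ k ∈ Finset.range n, a n k) atTop (𝓝 κ) := by
  rw [Metric.tendsto_nhds]
  intro ε hε
  have h1 := (Metric.tendsto_nhds.1 hL.tendsto_sum_nat (ε / 3) (by positivity)).and
    (hb.eventually (gt_mem_nhds (show 0 < ε / 3 by positivity)))
  obtain ⟨K, hK1, hK2⟩ := h1.exists
  have h2 := Metric.tendsto_nhds.1 (tendsto_finsetSum (Finset.range K) fun k _ => ha k) (ε / 3)
    (by positivity)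
  filter_upwards [h2, ht K] with n h3 h4
  rw [Real.dist_eq, abs_lt] at *
  rw [abs_le] at h4
  constructor <;> linarith [h3.1, h3.2, h4.1, h4.2, hK1.1, hK1.2]

section Limit

variable {q : ℕ → ℝ} {α : ℝ}

lemma sum_compLimit_le_one (hq0 : ∀ n, 0 ≤ q n) (hq1 : ∀ n, q n ≤ 1)
    (h : Tendsto (fun n => q n ^ n) atTop (𝓝 (Real.exp (-α)))) (K : ℕ) :
    ∑ k ∈ Finset.range K, compLimit α k ≤ 1 := by
  refine le_of_tendsto (tendsto_finsetSum (Finset.range K) fun k _ => tendsto_compMean_div hq0 h k)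
    ?_
  filter_upwards [eventually_pos_of_tendsto_pow hq0 h, eventually_ge_atTop (K + 1)] with n hn hK
  have hn0 : (0 : ℝ) < n := by exact_mod_cast (show 0 < n by omega)
  rw [← Finset.sum_div, div_le_one hn0]
  refine le_trans ?_ ((sum_compMean_le hn (hq1 n) n 0).trans_eq (by simp))
  exact Finset.sum_le_sum_of_subset_of_nonneg (fun k => by simp; omega)
    fun k _ _ => compMean_nonneg hn (hq1 n) n k

lemma summable_compLimit (hα : 0 ≤ α) (hq0 : ∀ n, 0 ≤ q n) (hq1 : ∀ n, q n ≤ 1)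
    (h : Tendsto (fun n => q n ^ n) atTop (𝓝 (Real.exp (-α)))) : Summable (compLimit α) :=
  summable_of_sum_range_le (compLimit_nonneg hα) (sum_compLimit_le_one hq0 hq1 h)

lemma tendsto_sum_compMean_div (hα : 0 ≤ α) (hq0 : ∀ n, 0 ≤ q n) (hq1 : ∀ n, q n ≤ 1)
    (h : Tendsto (fun n => q n ^ n) atTop (𝓝 (Real.exp (-α)))) :
    Tendsto (fun n => (∑ k ∈ Finset.range n, compMean (q n) n k) / n) atTop
      (𝓝 (∑' k, compLimit α k)) := by
  simp only [Finset.sum_div]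
  refine tendsto_sum_range_of_tail tendsto_one_div_add_atTop_nhds_zero_nat
    (summable_compLimit hα hq0 hq1 h).hasSum (tendsto_compMean_div hq0 h) fun K => ?_
  filter_upwards [eventually_pos_of_tendsto_pow hq0 h, eventually_ge_atTop (K + 1)] with n hn hK
  have hn0 : (0 : ℝ) < n := by exact_mod_cast (show 0 < n by omega)
  rw [← Finset.sum_Ico_eq_sub _ (by omega : K ≤ n), ← Finset.sum_div, abs_of_nonneg
    (div_nonneg (Finset.sum_nonneg fun k _ => compMean_nonneg hn (hq1 n) n k) hn0.le),
    div_le_iff₀ hn0]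
  refine (sum_compMean_le hn (hq1 n) n K).trans_eq (by ring)

end Limit

/-! ### The limit constant -/

lemma tsum_compLimit_of_pos {α : ℝ} (hα : 0 < α) :
    ∑' k, compLimit α k = beta (α * Real.exp (-α)) / α := by
  rw [beta, ← tsum_div_const]
  refine tsum_congr fun k => ?_
  have hk : ((k : ℝ) + 1) ≠ 0 := by positivity
  rw [compLimit, treePoly_one, treeTerm, zpow_sub₀ (by push_cast; exact hk), zpow_natCast]
  push_cast
  have e : ((k : ℝ) + 1) ^ (2 : ℤ) = (k + 1) * (k + 1) := by norm_cast; ring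
  rw [e]
  field_simp
  ring

lemma tsum_compLimit_zero : ∑' k, compLimit 0 k = 1 := by
  rw [tsum_eq_single 0 fun k hk => by simp [compLimit, hk]]
  simp [compLimit, treePoly]

/-! ### Factorial moments -/

/-- The normalized falling factorial differs from a power of the limit by the order of the deviation
of its argument. -/
lemma exists_descPochhammer_bound (s : ℕ) : ∃ C : ℝ, 0 ≤ C ∧ ∀ n : ℕ, 1 ≤ n → ∀ x κ : ℝ, 0 ≤ x →
    x ≤ n → 0 ≤ κ → κ ≤ 1 →
    |(descPochhammer ℝ s).eval (x - 1) / (n : ℝ) ^ s - κ ^ s| ≤ C * (|x / n - κ| + 1 / n) := by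
  induction s with
  | zero => exact ⟨0, le_rfl, fun n hn x κ _ _ _ _ => by simp⟩
  | succ s ih =>
    obtain ⟨C, hC, h⟩ := ih
    refine ⟨C * (s + 2) + (s + 1), by positivity, fun n hn x κ hx hxn hκ hκ1 => ?_⟩
    have hn0 : (1 : ℝ) ≤ n := by exact_mod_cast hn
    have hn1 : (0 : ℝ) < n := by linarith
    have h1 := h n hn x κ hx hxn hκ hκ1
    rw [descPochhammer_succ_eval]
    set A := (descPochhammer ℝ s).eval (x - 1) / (n : ℝ) ^ s with hA
    set δ := |x / n - κ| with hδ
    have hB : |(x - 1 - s) / n| ≤ s + 2 := by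
      rw [abs_div, abs_of_pos hn1, div_le_iff₀ hn1, abs_le]
      have : (0 : ℝ) ≤ s := Nat.cast_nonneg s
      constructor <;> nlinarith
    have hB' : |(x - 1 - s) / n - κ| ≤ δ + (s + 1) / n := by
      have : (x - 1 - s) / n - κ = (x / n - κ) - (s + 1) / n := by ring
      rw [this]
      refine (abs_sub _ _).trans (add_le_add_right ?_ _)
      rw [abs_of_nonneg (by positivity)]
    have hκs : |κ ^ s| ≤ 1 := by
      rw [abs_of_nonneg (by positivity)]
      exact pow_le_one₀ hκ hκ1
    have h2 : (descPochhammer ℝ s).eval (x - 1) * (x - 1 - s) / (n : ℝ) ^ (s + 1) - κ ^ (s + 1) =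
        (A - κ ^ s) * ((x - 1 - s) / n) + κ ^ s * ((x - 1 - s) / n - κ) := by
      rw [hA, pow_succ, pow_succ]
      field_simp
      ring
    have hδ0 : 0 ≤ δ := abs_nonneg _
    have hs : (0 : ℝ) ≤ s := Nat.cast_nonneg s
    rw [h2]
    calc _ ≤ |A - κ ^ s| * |(x - 1 - s) / n| + |κ ^ s| * |(x - 1 - s) / n - κ| := by
          rw [← abs_mul, ← abs_mul]; exact abs_add_le _ _
      _ ≤ C * (δ + 1 / n) * (s + 2) + 1 * (δ + (s + 1) / n) := by gcongr
      _ ≤ (C * (s + 2) + (s + 1)) * (δ + 1 / n) := by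
          have : (s + 1 : ℝ) / n = (s + 1) * (1 / n) := by ring
          rw [this]
          nlinarith [mul_nonneg hs hδ0]

/-- Concentration of the number of components in mean square gives concentration in mean. -/
lemma subsetMean_abs_sub_le {n : ℕ} (hn : 1 ≤ n) {p : ℝ} (hp0 : 0 ≤ p) (hp1 : p ≤ 1) (κ : ℝ) :
    subsetMean p (edgesInside (Finset.univ : Finset (Fin n)))
      (fun S => |(numComponents (graphOf S) : ℝ) / n - κ|) ≤
    √(((∑ k ∈ Finset.range n, compMean (1 - p) n k) / n - κ) ^ 2 + p) := by
  have hn1 : (0 : ℝ) < n := by exact_mod_cast hn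
  apply Real.le_sqrt_of_sq_le
  refine (sq_subsetMean_le hp0 hp1).trans ?_
  set E := edgesInside (Finset.univ : Finset (Fin n)) with hE
  set F : Finset (Sym2 (Fin n)) → ℝ := fun S => (numComponents (graphOf S) : ℝ) with hF
  have h1 : subsetMean p E F = ∑ k ∈ Finset.range n, compMean (1 - p) n k := by
    have := subsetMean_card_connectedComponent (V := Fin n) p
    simp only [Fintype.card_fin] at this
    exact this
  have h2 := subsetMean_sq_le (E := E) (F := F) hp0 hp1 abs_card_connectedComponent_insert
  have h3 : (E.card : ℝ) ≤ (n : ℝ) ^ 2 := by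
    rw [hE, card_edgesInside_univ]
    exact_mod_cast Nat.choose_le_pow n 2
  have h4 : subsetMean p E (fun S => |F S / n - κ| ^ 2) =
      (1 / (n : ℝ) ^ 2) * subsetMean p E (fun S => F S ^ 2) - 2 * κ / n * subsetMean p E F +
        κ ^ 2 := by
    rw [← subsetMean_const_mul, ← subsetMean_const_mul, ← subsetMean_sub,
      ← subsetMean_const (p := p) (E := E) (κ ^ 2), ← subsetMean_add]
    refine subsetMean_congr fun S _ => ?_
    rw [sq_abs]
    ring
  rw [h4, ← h1]
  have h5 : (1 / (n : ℝ) ^ 2) * subsetMean p E (fun S => F S ^ 2) ≤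
      (1 / (n : ℝ) ^ 2) * (subsetMean p E F ^ 2 + (n : ℝ) ^ 2 * p) := by
    gcongr
    exact h2.trans (by gcongr)
  refine (add_le_add_left (sub_le_sub_right h5 _) _).trans_eq ?_
  field_simp
  ring

lemma numComponents_le {n : ℕ} (g : SimpleGraph (Fin n)) : numComponents g ≤ n := by
  have := Nat.card_le_card_of_surjective g.connectedComponentMk
    (fun c => by induction c using SimpleGraph.ConnectedComponent.ind with | _ v => exact ⟨v, rfl⟩)
  simpa [numComponents] using this

/-- The limit of the normalized factorial moments. -/
lemma tendsto_factorialMoment_div {α : ℝ} (hα : 0 ≤ α) {p : ℕ → unitInterval}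
    (hp : Tendsto (fun n : ℕ => (1 - (p n : ℝ)) ^ n) atTop (𝓝 (Real.exp (-α)))) (s : ℕ) :
    Tendsto (fun n : ℕ => factorialMoment n (p n) s / (n : ℝ) ^ s) atTop
      (𝓝 ((∑' k, compLimit α k) ^ s)) := by
  have hq0 : ∀ n, 0 ≤ 1 - (p n : ℝ) := fun n => sub_nonneg.2 (p n).2.2
  have hq1 : ∀ n, 1 - (p n : ℝ) ≤ 1 := fun n => sub_le_self _ (p n).2.1
  set κ := ∑' k, compLimit α k with hκ
  have hκ0 : 0 ≤ κ := tsum_nonneg (compLimit_nonneg hα)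
  have hκ1 : κ ≤ 1 := Real.tsum_le_of_sum_range_le (compLimit_nonneg hα)
    (sum_compLimit_le_one hq0 hq1 hp)
  obtain ⟨C, hC, hbound⟩ := exists_descPochhammer_bound s
  have hp' : Tendsto (fun n => (p n : ℝ)) atTop (𝓝 0) := by
    simpa using (tendsto_one_of_tendsto_pow hq0 hp).const_sub 1
  have h1 : Tendsto (fun n : ℕ => C * (√(((∑ k ∈ Finset.range n, compMean (1 - (p n : ℝ)) n k) / n -
      κ) ^ 2 + p n) + 1 / n)) atTop (𝓝 0) := by
    have h2 := ((((tendsto_sum_compMean_div hα hq0 hq1 hp).sub_const κ).pow 2).add hp').sqrt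
    have h3 := (h2.add tendsto_one_div_atTop_nhds_zero_nat).const_mul C
    simpa [← hκ] using h3
  rw [tendsto_iff_dist_tendsto_zero]
  refine squeeze_zero' (Eventually.of_forall fun n => dist_nonneg) ?_ h1
  filter_upwards [eventually_ge_atTop 1] with n hn
  have hp0 := (p n).2.1
  have hp1 := (p n).2.2
  set E := edgesInside (Finset.univ : Finset (Fin n))
  set F : Finset (Sym2 (Fin n)) → ℝ := fun S => (numComponents (graphOf S) : ℝ) with hF
  have h4 : factorialMoment n (p n) s / (n : ℝ) ^ s - κ ^ s = subsetMean (p n) E fun S =>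
      (descPochhammer ℝ s).eval (F S - 1) / (n : ℝ) ^ s - κ ^ s := by
    rw [subsetMean_sub, subsetMean_const, factorialMoment, integral_binomialRandom,
      div_eq_inv_mul, ← subsetMean_const_mul]
    simp only [div_eq_inv_mul, hF, E]
  have h5 : ∀ S ⊆ E, |(descPochhammer ℝ s).eval (F S - 1) / (n : ℝ) ^ s - κ ^ s| ≤
      C * (|F S / n - κ| + 1 / n) := fun S _ =>
    hbound n hn (F S) κ (Nat.cast_nonneg _) (Nat.cast_le.2 (numComponents_le (graphOf S))) hκ0 hκ1
  have h6 : subsetMean (p n) E (fun S => C * (|F S / n - κ| + 1 / n)) ≤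
      C * (√(((∑ k ∈ Finset.range n, compMean (1 - (p n : ℝ)) n k) / n - κ) ^ 2 + p n) + 1 / n) := by
    rw [subsetMean_const_mul, subsetMean_add, subsetMean_const]
    gcongr
    exact subsetMean_abs_sub_le hn hp0 hp1 κ
  rw [Real.dist_eq, h4, abs_le]
  constructor
  · rw [neg_le]
    refine le_trans ?_ h6
    rw [← neg_one_mul, ← subsetMean_const_mul]
    exact subsetMean_mono hp0 hp1 fun S hS => by
      rw [neg_one_mul]; exact (neg_le_abs _).trans (h5 S hS)
  · exact (subsetMean_mono hp0 hp1 fun S hS => (le_abs_self _).trans (h5 S hS)).trans h6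

end ErdosRenyi

theorem mainTheorem2 (α : ℝ) (hα : 0 ≤ α) (p : ℕ → unitInterval)
    (hp : Tendsto (fun n : ℕ => (1 - (p n : ℝ)) ^ n) atTop (𝓝 (Real.exp (-α)))) (s : ℕ) :
    (0 < α →
      (fun n : ℕ => ErdosRenyi.factorialMoment n (p n) s) ~[atTop]
        (fun n : ℕ => ((n : ℝ) / α * ErdosRenyi.beta (α * Real.exp (-α))) ^ s)) ∧
    (α = 0 →
      (fun n : ℕ => ErdosRenyi.factorialMoment n (p n) s) ~[atTop]
        (fun n : ℕ => (n : ℝ) ^ s)) := by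
  have hlim := ErdosRenyi.tendsto_factorialMoment_div hα hp s
  have hq0 : ∀ n, 0 ≤ 1 - (p n : ℝ) := fun n => sub_nonneg.2 (p n).2.2
  have hq1 : ∀ n, 1 - (p n : ℝ) ≤ 1 := fun n => sub_le_self _ (p n).2.1
  set κ := ∑' k, ErdosRenyi.compLimit α k with hκ
  -- isolated vertices alone contribute `exp (-α) > 0` to the limit
  have hκ0 : 0 < κ := (ErdosRenyi.summable_compLimit hα hq0 hq1 hp).tsum_pos
    (ErdosRenyi.compLimit_nonneg hα) 0 (by simp [ErdosRenyi.compLimit, ErdosRenyi.treePoly,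
      Real.exp_pos])
  have key : (fun n : ℕ => ErdosRenyi.factorialMoment n (p n) s) ~[atTop]
      fun n : ℕ => ((n : ℝ) * κ) ^ s := by
    have hne : ∀ᶠ n : ℕ in atTop, ((n : ℝ) * κ) ^ s ≠ 0 := by
      filter_upwards [eventually_ge_atTop 1] with n hn
      have : (0 : ℝ) < n := by exact_mod_cast hn
      positivity
    rw [isEquivalent_iff_tendsto_one hne]
    have h1 := hlim.div_const (κ ^ s)
    rw [div_self (by positivity)] at h1
    refine h1.congr fun n => ?_
    simp only [Pi.div_apply]
    rw [mul_pow, div_div]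
  refine ⟨fun h0 => ?_, fun h0 => ?_⟩
  · rw [hκ, ErdosRenyi.tsum_compLimit_of_pos h0] at key
    refine key.congr_right (Eventually.of_forall fun n => ?_)
    ring
  · rw [hκ, h0, ErdosRenyi.tsum_compLimit_zero] at key
    simpa using key
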